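/- Let $(\mathbb X,\mathfrak A)$ be a measurable space and let $f:\mathbb X\to\mathbb X$ be bimeasurable, i.e. $f^{-1}(A)\in\mathfrak A$ and $f(A)\in\mathfrak A$ for every $A\in\mathfrak A$. Write $\mathbb N=\{1,2,3,\dots\}$, give its power set $2^{\mathbb N}\cong\{0,1\}^{\mathbb N}$ the product (Borel) $\sigma$-algebra, and for $U\subset\mathbb N$ let $\mathbb d^+_{\mathbb N}(U)=\limsup_{n\to\infty}\frac1n\#(\{1,\dots,n\}\cap U)$. A coherent schedule of events for $f$ is a measurable map $\mathcal U:\mathbb X\to 2^{\mathbb N}$ such that, for every $x\in\mathbb X$: (1) $n\in\mathcal U(x)$ implies $n-j\in\mathcal U(f^j(x))$ for all $n>j\ge 0$; (2) $n\in\mathcal U(x)$ and $m\in\mathcal U(f^n(x))$ imply $n+m\in\mathcal U(x)$ for all $n,m\ge1$. **Theorem (Synchronization for invariant measures).** Let $\mu$ be an ergodic $f$-invariant probability measure on $(\mathbb X,\mathfrak A)$, let $m\ge 0$, and let $\mathcal U_0,\dots,\mathcal U_m:\mathbb X\to2^{\mathbb N}$ be coherent schedules of events for $f$ such that $\mathbb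 d_{\mathbb N}^+(\mathcal U_i(x))>0$ for $\mu$-almost every $x\in\mathbb X$ and every $0\le i\le m$. Then there are integers $\ell_1,\dots,\ell_m\ge 0$ and a real number $\theta>0$ such that, for $\mu$-almost every $x\in\mathbb X$, $$\lim_{n\to\infty}\frac1n\#\big\{0\le j<n \,:\, (j,j+\ell_1,\dots,j+\ell_m)\in\mathcal U_0(x)\times\mathcal U_1(x)\times\cdots\times\mathcal U_m(x)\big\}=\theta.$$ -/

import Mathlib

open Filter Topology MeasureTheory

namespace ScheduleSync

/-- A self-map of a measurable space is bimeasurable if preimages and direct images of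
measurable sets are measurable. -/
structure IsBimeasurable {X : Type*} [MeasurableSpace X] (f : X → X) : Prop where
  measurable : Measurable f
  measurableSet_image : ∀ s : Set X, MeasurableSet s → MeasurableSet (f '' s)

/-- The number of `j ∈ {1, …, n}` with `j ∈ U`, divided by `n`. -/
noncomputable def frequency (U : Set ℕ) (n : ℕ) : ℝ :=
  (Set.ncard {j : ℕ | 1 ≤ j ∧ j ≤ n ∧ j ∈ U} : ℝ) / (n : ℝ)

/-- Upper density of a set of positive integers. The frequencies lie in `[0, 1]`, so this real
`limsup` is a genuine one. -/
noncomputable def upperDensity (U : Set ℕ) : ℝ :=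
  limsup (fun n : ℕ => frequency U n) atTop

/-- An `f`-coherent schedule of events: a measurable map `𝒰` from `X` to the power set of the set
`{1, 2, 3, …}` of positive integers (a subset of it is encoded as a set of natural numbers without
`0`) with the two coherence properties. `Set ℕ` carries the product `σ`-algebra of `ℕ → Prop`,
which is the Borel `σ`-algebra of the Cantor metric `2 ^ (-min (A ∆ B))`. -/
structure IsCoherentSchedule {X : Type*} [MeasurableSpace X] (f : X → X) (𝒰 : X → Set ℕ) :
    Prop where
  measurable : Measurable 𝒰
  pos : ∀ x : X, ∀ n ∈ 𝒰 x, 1 ≤ n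
  sub_mem : ∀ (x : X) (n j : ℕ), j < n → n ∈ 𝒰 x → n - j ∈ 𝒰 (f^[j] x)
  add_mem : ∀ (x : X) (n m : ℕ), 1 ≤ n → 1 ≤ m →
    n ∈ 𝒰 x → m ∈ 𝒰 (f^[n] x) → n + m ∈ 𝒰 x

end ScheduleSync

namespace ScheduleSync

variable {X : Type*} {f : X → X}

/-! Seen from `f^[i] x`, an event at time `N + 1 + i` is an event at time `N + 1`. By invariance,
the probability of an event at time `n ≥ 1` therefore decreases to its infimum `d`. The event
frequency tends to `d` almost everywhere (`IsBackwardCoherent.ae_tendsto`): from above, because late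
events are visits to `{N + 1 ∈ W}`, counted by Birkhoff; from below, because the event count is
subadditive with mean at least `n * d`. So positive upper density forces `d > 0`.

This property passes to the intersection with a shifted schedule, so it remains to find shifts
keeping `d` positive (`exists_eventDensity_inter_shift_pos`). Ergodicity makes the two events at a
large fixed time overlap after a shift, and little of the overlap is lost later, both probabilities
being already close to their limits. -/

lemma birkhoffSum_indicator_nonneg (A : Set X) (n : ℕ) (x : X) :
    0 ≤ birkhoffSum f (A.indicator (1 : X → ℝ)) n x :=
  Finset.sum_nonneg fun _ _ => Set.indicator_nonneg (fun _ _ => zero_le_one) _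

lemma birkhoffSum_indicator_le (A : Set X) (n : ℕ) (x : X) :
    birkhoffSum f (A.indicator (1 : X → ℝ)) n x ≤ n := by
  refine (Finset.sum_le_card_nsmul _ _ 1 fun i _ => ?_).trans (by simp)
  exact Set.indicator_le_self' (fun _ _ => zero_le_one) _

/-- Greedy decomposition of an orbit into blocks on which a subadditive process has slope at most
`c`, and steps spent in the set `B` where no such block of length at most `M` starts. -/
lemma subadditive_le_of_short_blocks {g : ℕ → X → ℝ} {c : ℝ} (hc : 0 ≤ c)
    (hle : ∀ n x, g n x ≤ n)
    (hsub : ∀ m n x, g (m + n) x ≤ g m x + g n (f^[m] x)) (B : Set X) (M : ℕ)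
    (hB : ∀ x ∉ B, ∃ n, 1 ≤ n ∧ n ≤ M ∧ g n x ≤ c * n) (T : ℕ) :
    ∀ x, g T x ≤ c * T + birkhoffSum f (B.indicator 1) T x + M := by
  have hpos := birkhoffSum_indicator_nonneg (f := f) B
  induction T using Nat.strong_induction_on with
  | _ T ih =>
    intro x
    rcases le_or_gt T M with hTM | hTM
    · have h1 : (T : ℝ) ≤ M := by exact_mod_cast hTM
      have h2 : 0 ≤ c * (T : ℝ) := by positivity
      linarith [hle T x, hpos T x]
    by_cases hx : x ∈ B
    · obtain ⟨S, rfl⟩ : ∃ S, T = 1 + S := ⟨T - 1, by omega⟩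
      have h1 := hsub 1 S x
      have h2 := ih S (by omega) (f^[1] x)
      have h3 := hle 1 x
      rw [birkhoffSum_add, birkhoffSum_one, Set.indicator_of_mem hx]
      push_cast at *
      simp only [Pi.one_apply]
      linarith
    · obtain ⟨n, hn1, hnM, hn⟩ := hB x hx
      obtain ⟨S, rfl⟩ : ∃ S, T = n + S := ⟨T - n, by omega⟩
      have h1 := hsub n S x
      have h2 := ih S (by omega) (f^[n] x)
      rw [birkhoffSum_add]
      push_cast at *
      linarith [hpos n x]

/-- The number of elements of `W x` in `{1, …, n}`. -/
noncomputable def eventCount (W : X → Set ℕ) (n : ℕ) (x : X) : ℝ :=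
  ∑ i ∈ Finset.range n, {y | i + 1 ∈ W y}.indicator 1 x

lemma ncard_lt_succ_and_mem (W : X → Set ℕ) (x : X) (h0 : 0 ∉ W x) (n : ℕ) :
    (Set.ncard {j : ℕ | j < n + 1 ∧ j ∈ W x} : ℝ) = eventCount W n x := by
  classical
  have : {j : ℕ | j < n + 1 ∧ j ∈ W x} = ((Finset.range (n + 1)).filter (· ∈ W x) : Finset ℕ) := by
    ext j; simp
  rw [this, Set.ncard_coe_finset, Finset.card_filter, Finset.sum_range_succ', if_neg h0]
  simp [eventCount, Set.indicator_apply]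

lemma frequency_eq (W : X → Set ℕ) (x : X) (h0 : 0 ∉ W x) (n : ℕ) :
    frequency (W x) n = eventCount W n x / n := by
  rw [frequency, ← ncard_lt_succ_and_mem W x h0]
  congr 4
  ext j
  constructor
  · rintro ⟨_, h2, h3⟩
    exact ⟨by omega, h3⟩
  · rintro ⟨h2, h3⟩
    exact ⟨Nat.pos_of_ne_zero fun h => h0 (h ▸ h3), by omega, h3⟩

/-! ### Subadditive and Birkhoff ergodic theorems -/

variable [MeasurableSpace X] {μ : Measure X}

lemma measurable_birkhoffSum_indicator (hf : Measurable f) {A : Set X} (hA : MeasurableSet A)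
    (n : ℕ) : Measurable (birkhoffSum f (A.indicator (1 : X → ℝ)) n) := by
  unfold birkhoffSum
  exact Finset.measurable_sum _ fun i _ =>
    (measurable_one.indicator hA).comp (hf.iterate i)

lemma integrable_of_nonneg_of_le [IsFiniteMeasure μ] {h : X → ℝ} {C : ℝ} (hm : Measurable h)
    (h0 : ∀ x, 0 ≤ h x) (hC : ∀ x, h x ≤ C) : Integrable h μ :=
  Integrable.of_bound hm.aestronglyMeasurable C
    (Eventually.of_forall fun x => by rw [Real.norm_of_nonneg (h0 x)]; exact hC x)

lemma integral_birkhoffSum_indicator [IsProbabilityMeasure μ] (hf : MeasurePreserving f μ μ)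
    {A : Set X} (hA : MeasurableSet A) (n : ℕ) :
    ∫ x, birkhoffSum f (A.indicator (1 : X → ℝ)) n x ∂μ = n * μ.real A := by
  have key : ∀ i x, A.indicator (1 : X → ℝ) (f^[i] x) = (f^[i] ⁻¹' A).indicator 1 x :=
    fun i x => rfl
  simp only [birkhoffSum, key]
  rw [integral_finsetSum]
  · simp only [integral_indicator_one ((hf.measurable.iterate _) hA),
      (hf.iterate _).measureReal_preimage hA.nullMeasurableSet]
    simp
  · intro i _
    exact (integrable_const (1 : ℝ)).indicator ((hf.measurable.iterate _) hA)

/-- The lower half of the subadditive ergodic theorem, for processes with bounded increments. -/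
lemma ae_eventually_lt_of_subadditive [IsProbabilityMeasure μ] (hf : Ergodic f μ)
    {g : ℕ → X → ℝ} (hg : ∀ n, Measurable (g n)) (h0 : ∀ n x, 0 ≤ g n x) (hle : ∀ n x, g n x ≤ n)
    (hsub : ∀ m n x, g (m + n) x ≤ g m x + g n (f^[m] x)) {θ : ℝ}
    (hθ : ∀ n : ℕ, n * θ ≤ ∫ x, g n x ∂μ) {c : ℝ} (hc : 0 ≤ c) (hcθ : c < θ) :
    ∀ᵐ x ∂μ, ∃ k : ℕ, ∀ᶠ n : ℕ in atTop, c * n < g n x + k := by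
  set E : Set X := {x | ∀ k : ℕ, ∃ᶠ n : ℕ in atTop, g n x + k ≤ c * n} with hE
  have hEm : MeasurableSet E := by
    have : E = ⋂ k : ℕ, ⋂ N : ℕ, ⋃ n : ℕ, ⋃ _ : N ≤ n, {x | g n x + k ≤ c * n} := by
      ext x; simp [hE, frequently_atTop]
    rw [this]
    exact .iInter fun k => .iInter fun N => .iUnion fun n => .iUnion fun _ =>
      measurableSet_le ((hg n).add_const _) measurable_const
  -- One step costs at most `1`, which the quantifier over `k` absorbs.
  have hEf : f ⁻¹' E ⊆ E := by
    intro x hx k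
    rw [frequently_atTop]
    intro N
    obtain ⟨n, hn, hnx⟩ := (frequently_atTop.1 (hx (k + 1))) N
    refine ⟨1 + n, by omega, ?_⟩
    have h1 := hsub 1 n x
    have h2 := hle 1 x
    simp only [Function.iterate_one] at h1
    push_cast at *
    linarith
  rcases hf.ae_empty_or_univ_of_preimage_ae_le hEm.nullMeasurableSet hEf.eventuallyLE with h | h
  · filter_upwards [eventuallyEq_empty.1 h] with x hx
    simpa [hE, not_frequently] using hx
  · exfalso
    set B : ℕ → Set X := fun M => {x | ∀ n, 1 ≤ n → n ≤ M → c * n < g n x} with hB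
    have hBm : ∀ M, MeasurableSet (B M) := by
      intro M
      have : B M = ⋂ n : ℕ, ⋂ _ : 1 ≤ n, ⋂ _ : n ≤ M, {x | c * n < g n x} := by
        ext x; simp [hB]
      rw [this]
      exact .iInter fun n => .iInter fun _ => .iInter fun _ =>
        measurableSet_lt measurable_const (hg n)
    have hBanti : Antitone B := fun M M' hM x hx n h1 h2 => hx n h1 (h2.trans hM)
    have hlim := tendsto_measure_iInter_atTop (μ := μ)
      (fun M => (hBm M).nullMeasurableSet) hBanti ⟨0, measure_ne_top _ _⟩
    -- Every point of `E` starts a block of slope at most `c`: take `k = 0`.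
    have hnull : μ (⋂ M, B M) = 0 := by
      rw [measure_eq_zero_iff_ae_notMem]
      filter_upwards [eventuallyEq_univ.1 h] with x hx hxB
      obtain ⟨n, hn, hnx⟩ := (frequently_atTop.1 (hx 0)) 1
      have := Set.mem_iInter.1 hxB n n hn le_rfl
      simp at hnx
      linarith
    rw [hnull] at hlim
    have hlim' : Tendsto (fun M => μ.real (B M)) atTop (𝓝 0) := by
      simpa [Measure.real, Function.comp_def] using (ENNReal.tendsto_toReal ENNReal.zero_ne_top).comp hlim
    obtain ⟨M, hM⟩ := (hlim'.eventually_lt_const (sub_pos.2 hcθ)).exists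
    have hbound : ∀ T : ℕ, T * θ ≤ c * T + T * μ.real (B M) + M := by
      intro T
      refine (hθ T).trans ?_
      have hpt := subadditive_le_of_short_blocks hc hle hsub (B M) M
        (fun x hx => by simpa [hB] using hx) T
      have hint : Integrable (birkhoffSum f ((B M).indicator (1 : X → ℝ)) T) μ :=
        integrable_of_nonneg_of_le (measurable_birkhoffSum_indicator hf.measurable (hBm M) T)
          (birkhoffSum_indicator_nonneg _ _) (birkhoffSum_indicator_le _ _)
      calc ∫ x, g T x ∂μ
          ≤ ∫ x, (c * T + M) + birkhoffSum f ((B M).indicator (1 : X → ℝ)) T x ∂μ := by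
            refine integral_mono (integrable_of_nonneg_of_le (hg T) (h0 T) (hle T))
              ((integrable_const _).add hint) fun x => ?_
            have := hpt x
            simp only
            linarith
        _ = c * T + T * μ.real (B M) + M := by
            rw [integral_add (integrable_const _) hint,
              integral_birkhoffSum_indicator hf.toMeasurePreserving (hBm M)]
            simp
            ring
    -- `hbound` reads `T * (θ - c - μ.real (B M)) ≤ M`, which fails for large `T`.
    obtain ⟨T, hT⟩ := exists_nat_gt (M / (θ - c - μ.real (B M)))
    rw [div_lt_iff₀ (by linarith)] at hT
    linarith [hbound T]

/-- Pointwise lower bound for the averages of a subadditive process. -/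
lemma ae_eventually_lt_div_of_subadditive [IsProbabilityMeasure μ] (hf : Ergodic f μ)
    {g : ℕ → X → ℝ} (hg : ∀ n, Measurable (g n)) (h0 : ∀ n x, 0 ≤ g n x) (hle : ∀ n x, g n x ≤ n)
    (hsub : ∀ m n x, g (m + n) x ≤ g m x + g n (f^[m] x)) {θ : ℝ}
    (hθ : ∀ n : ℕ, n * θ ≤ ∫ x, g n x ∂μ) :
    ∀ᵐ x ∂μ, ∀ c < θ, ∀ᶠ n : ℕ in atTop, c < g n x / n := by
  have key : ∀ᵐ x ∂μ, ∀ q : ℚ, 0 ≤ (q : ℝ) → (q : ℝ) < θ →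
      ∃ k : ℕ, ∀ᶠ n : ℕ in atTop, (q : ℝ) * n < g n x + k := by
    rw [ae_all_iff]
    intro q
    by_cases h1 : 0 ≤ (q : ℝ)
    · by_cases h2 : (q : ℝ) < θ
      · filter_upwards [ae_eventually_lt_of_subadditive hf hg h0 hle hsub hθ h1 h2] with x hx
        exact fun _ _ => hx
      · simp [h2]
    · simp [h1]
  filter_upwards [key] with x hx c hc
  rcases lt_or_ge c 0 with hc0 | hc0
  · exact Eventually.of_forall fun n => hc0.trans_le (div_nonneg (h0 n x) n.cast_nonneg)
  obtain ⟨q, hcq, hqθ⟩ := exists_rat_btwn hc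
  obtain ⟨k, hk⟩ := hx q (hc0.trans hcq.le) hqθ
  have hlim : Tendsto (fun n : ℕ => (k : ℝ) / n) atTop (𝓝 0) := tendsto_const_div_atTop_nhds_zero_nat _
  filter_upwards [hk, hlim.eventually_lt_const (sub_pos.2 hcq), eventually_gt_atTop 0]
    with n h1 h2 h3
  have h3' : (0 : ℝ) < n := by exact_mod_cast h3
  rw [div_lt_iff₀ h3'] at h2
  rw [lt_div_iff₀ h3']
  linarith

/-- Birkhoff's theorem for indicator functions. -/
lemma ae_tendsto_birkhoffSum_indicator [IsProbabilityMeasure μ] (hf : Ergodic f μ)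
    {A : Set X} (hA : MeasurableSet A) :
    ∀ᵐ x ∂μ, Tendsto (fun n : ℕ => birkhoffSum f (A.indicator (1 : X → ℝ)) n x / n) atTop
      (𝓝 (μ.real A)) := by
  have lower : ∀ {B : Set X}, MeasurableSet B → ∀ᵐ x ∂μ, ∀ c < μ.real B,
      ∀ᶠ n : ℕ in atTop, c < birkhoffSum f (B.indicator (1 : X → ℝ)) n x / n := fun {B} hB =>
    ae_eventually_lt_div_of_subadditive hf (measurable_birkhoffSum_indicator hf.measurable hB)
      (birkhoffSum_indicator_nonneg B) (birkhoffSum_indicator_le B)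
      (fun m n x => (birkhoffSum_add f _ m n x).le)
      (fun n => (integral_birkhoffSum_indicator hf.toMeasurePreserving hB n).ge)
  -- The upper bound for `A` is the lower bound for its complement.
  filter_upwards [lower hA, lower hA.compl] with x h1 h2
  refine tendsto_order.2 ⟨h1, fun c hc => ?_⟩
  have h3 := h2 (1 - c) (by rw [probReal_compl_eq_one_sub hA]; linarith)
  filter_upwards [h3, eventually_gt_atTop 0] with n hn hn0
  have hn0' : (0 : ℝ) < n := by exact_mod_cast hn0
  have hsum : birkhoffSum f (A.indicator (1 : X → ℝ)) n x
      + birkhoffSum f (Aᶜ.indicator (1 : X → ℝ)) n x = n := by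
    simp only [birkhoffSum, ← Finset.sum_add_distrib]
    rw [Finset.sum_congr rfl fun i _ => Set.indicator_self_add_compl_apply A 1 _]
    simp
  have : birkhoffSum f (A.indicator (1 : X → ℝ)) n x / n
      = 1 - birkhoffSum f (Aᶜ.indicator (1 : X → ℝ)) n x / n := by
    field_simp
    linarith
  rw [this]
  linarith

/-! ### Backward coherent families and their event frequencies -/

/-- A measurable family of sets of times satisfying the first coherence property only. -/
structure IsBackwardCoherent (f : X → X) (W : X → Set ℕ) : Prop where
  measurableSet_mem : ∀ n, MeasurableSet {x | n ∈ W x}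
  sub_mem : ∀ (x : X) (n j : ℕ), j < n → n ∈ W x → n - j ∈ W (f^[j] x)

lemma IsCoherentSchedule.isBackwardCoherent {U : X → Set ℕ} (hU : IsCoherentSchedule f U) :
    IsBackwardCoherent f U where
  measurableSet_mem n := hU.measurable (measurableSet_mem n)
  sub_mem := hU.sub_mem

lemma IsBackwardCoherent.inter_shift {W U : X → Set ℕ} (hW : IsBackwardCoherent f W)
    (hU : IsBackwardCoherent f U) (ℓ : ℕ) :
    IsBackwardCoherent f fun x => {n | n ∈ W x ∧ n + ℓ ∈ U x} where
  measurableSet_mem n := (hW.measurableSet_mem n).inter (hU.measurableSet_mem (n + ℓ))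
  sub_mem x n j hj h := by
    refine ⟨hW.sub_mem x n j hj h.1, ?_⟩
    have := hU.sub_mem x (n + ℓ) j (by omega) h.2
    rwa [show n + ℓ - j = n - j + ℓ by omega] at this

/-- The limit, which is the infimum, of the probabilities that `n ∈ W x`. -/
noncomputable def eventDensity (μ : Measure X) (W : X → Set ℕ) : ℝ :=
  ⨅ n : ℕ, μ.real {x | n + 1 ∈ W x}

lemma eventDensity_le (W : X → Set ℕ) (n : ℕ) :
    eventDensity μ W ≤ μ.real {x | n + 1 ∈ W x} :=
  ciInf_le ⟨0, by rintro _ ⟨n, rfl⟩; exact measureReal_nonneg⟩ n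

lemma IsBackwardCoherent.setOf_mem_subset {W : X → Set ℕ} (hW : IsBackwardCoherent f W)
    (N i : ℕ) : {x | N + 1 + i ∈ W x} ⊆ f^[i] ⁻¹' {x | N + 1 ∈ W x} := by
  intro x hx
  have := hW.sub_mem x (N + 1 + i) i (by omega) hx
  rwa [Nat.add_sub_cancel] at this

/-- For backward coherent families, the frequency of events converges almost everywhere. -/
lemma IsBackwardCoherent.ae_tendsto [IsProbabilityMeasure μ] (hf : Ergodic f μ)
    {W : X → Set ℕ} (hW : IsBackwardCoherent f W) :
    ∀ᵐ x ∂μ, Tendsto (fun n : ℕ => eventCount W n x / n) atTop (𝓝 (eventDensity μ W)) := by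
  have hm : ∀ n, Measurable (eventCount W n) := fun n => by
    unfold eventCount
    exact Finset.measurable_sum _ fun i _ =>
      measurable_one.indicator (hW.measurableSet_mem (i + 1))
  have hind0 : ∀ (B : Set X) x, 0 ≤ B.indicator (1 : X → ℝ) x := fun B x =>
    Set.indicator_nonneg (fun _ _ => zero_le_one) _
  have hind1 : ∀ (B : Set X) x, B.indicator (1 : X → ℝ) x ≤ 1 := fun B x =>
    Set.indicator_le_self' (fun _ _ => zero_le_one) _
  have hle : ∀ n x, eventCount W n x ≤ n := fun n x =>
    (Finset.sum_le_card_nsmul _ _ 1 fun i _ => hind1 _ _).trans (by simp)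
  have hstep : ∀ N i x, {y | N + 1 + i ∈ W y}.indicator (1 : X → ℝ) x
      ≤ {y | N + 1 ∈ W y}.indicator 1 (f^[i] x) := fun N i x =>
    Set.indicator_le_indicator_of_subset (hW.setOf_mem_subset N i) (fun _ => zero_le_one) x
  have hsub : ∀ m n x, eventCount W (m + n) x ≤ eventCount W m x + eventCount W n (f^[m] x) := by
    intro m n x
    unfold eventCount
    rw [Finset.sum_range_add]
    gcongr with i
    have := hstep i m x
    rwa [show i + 1 + m = m + i + 1 by omega] at this
  have hint : ∀ n : ℕ, n * eventDensity μ W ≤ ∫ x, eventCount W n x ∂μ := by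
    intro n
    unfold eventCount
    rw [integral_finsetSum]
    swap
    · exact fun i _ => (integrable_const (1 : ℝ)).indicator (hW.measurableSet_mem (i + 1))
    simp only [integral_indicator_one (hW.measurableSet_mem _)]
    simpa using Finset.card_nsmul_le_sum (Finset.range n) _ _ fun i _ => eventDensity_le (μ := μ) W i
  have hup : ∀ᵐ x ∂μ, ∀ N : ℕ, Tendsto
      (fun n : ℕ => birkhoffSum f ({y | N + 1 ∈ W y}.indicator (1 : X → ℝ)) n x / n) atTop
      (𝓝 (μ.real {y | N + 1 ∈ W y})) :=
    ae_all_iff.2 fun N => ae_tendsto_birkhoffSum_indicator hf (hW.measurableSet_mem (N + 1))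
  filter_upwards [ae_eventually_lt_div_of_subadditive hf hm
    (fun n x => Finset.sum_nonneg fun i _ => hind0 _ _) hle hsub hint, hup] with x h1 h2
  refine tendsto_order.2 ⟨h1, fun c hc => ?_⟩
  -- Beyond the first `N` times, every event is a visit to `{N + 1 ∈ W}`.
  obtain ⟨N, hN⟩ := exists_lt_of_ciInf_lt hc
  have hlim := (h2 N).add (tendsto_const_div_atTop_nhds_zero_nat (N : ℝ))
  rw [add_zero] at hlim
  filter_upwards [hlim.eventually_lt_const hN] with n hn
  refine lt_of_le_of_lt ?_ hn
  rw [← add_div]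
  gcongr
  have hmono : eventCount W n x ≤ eventCount W (N + n) x :=
    Finset.sum_le_sum_of_subset_of_nonneg (Finset.range_mono (by omega)) fun i _ _ => hind0 _ _
  have hsplit : eventCount W (N + n) x ≤ N + birkhoffSum f
      ({y | N + 1 ∈ W y}.indicator (1 : X → ℝ)) n x := by
    unfold eventCount birkhoffSum
    rw [Finset.sum_range_add]
    refine add_le_add (hle N x) (Finset.sum_le_sum fun i _ => ?_)
    have := hstep N i x
    rwa [show N + 1 + i = N + i + 1 by omega] at this
  linarith

/-! ### Synchronization by time shifts -/

/-- Integrating Birkhoff's theorem for `B` over `A`, the Cesàro means of `μ.real (A ∩ f^[ℓ] ⁻¹' B)`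
tend to `μ.real A * μ.real B`, so not all terms can be at most `c`. -/
lemma exists_measureReal_inter_preimage_gt [IsProbabilityMeasure μ] (hf : Ergodic f μ)
    {A B : Set X} (hB : MeasurableSet B) {c : ℝ}
    (hc : c < μ.real A * μ.real B) : ∃ ℓ : ℕ, c < μ.real (A ∩ f^[ℓ] ⁻¹' B) := by
  by_contra! hcon
  refine hc.not_ge ?_
  have hmeas : ∀ n : ℕ, Measurable fun x => birkhoffSum f (B.indicator (1 : X → ℝ)) n x / n :=
    fun n => (measurable_birkhoffSum_indicator hf.measurable hB n).div_const _
  have hlim : Tendsto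
      (fun n : ℕ => ∫ x in A, birkhoffSum f (B.indicator (1 : X → ℝ)) n x / n ∂μ) atTop
      (𝓝 (∫ _ in A, μ.real B ∂μ)) := by
    refine tendsto_integral_of_dominated_convergence (fun _ => (1 : ℝ))
      (fun n => (hmeas n).aestronglyMeasurable) (integrable_const _)
      (fun n => Eventually.of_forall fun x => ?_)
      (ae_restrict_of_ae (ae_tendsto_birkhoffSum_indicator hf hB))
    rw [Real.norm_of_nonneg (div_nonneg (birkhoffSum_indicator_nonneg B n x) n.cast_nonneg)]
    exact div_le_one_of_le₀ (birkhoffSum_indicator_le B n x) n.cast_nonneg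
  rw [setIntegral_const, smul_eq_mul] at hlim
  refine le_of_tendsto hlim ?_
  filter_upwards [eventually_gt_atTop 0] with n hn
  have hn' : (0 : ℝ) < n := by exact_mod_cast hn
  rw [integral_div, div_le_iff₀ hn']
  unfold birkhoffSum
  have hpre : ∀ i, MeasurableSet (f^[i] ⁻¹' B) := fun i => (hf.measurable.iterate i) hB
  have key : ∀ i x, B.indicator (1 : X → ℝ) (f^[i] x) = (f^[i] ⁻¹' B).indicator 1 x :=
    fun i x => rfl
  simp only [key]
  rw [integral_finsetSum]
  swap
  · exact fun i _ => (integrable_const (1 : ℝ)).indicator (hpre i)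
  simp only [integral_indicator_one (hpre _), measureReal_restrict_apply (hpre _),
    Set.inter_comm _ A]
  simpa [mul_comm] using Finset.sum_le_card_nsmul (Finset.range n) _ c fun i _ => hcon i

/-- The measure of the points whose `i`-th iterate has an event at time `N + 1` which is not
an event of the point itself. -/
lemma IsBackwardCoherent.measureReal_diff_le [IsProbabilityMeasure μ]
    (hf : MeasurePreserving f μ μ) {W : X → Set ℕ} (hW : IsBackwardCoherent f W) (N i : ℕ) :
    μ.real (f^[i] ⁻¹' {x | N + 1 ∈ W x} \ {x | N + 1 + i ∈ W x})
      ≤ μ.real {x | N + 1 ∈ W x} - eventDensity μ W := by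
  rw [measureReal_sdiff (hW.setOf_mem_subset N i) (hW.measurableSet_mem _),
    (hf.iterate i).measureReal_preimage (hW.measurableSet_mem _).nullMeasurableSet]
  have := eventDensity_le (μ := μ) W (N + i)
  rw [show N + i + 1 = N + 1 + i by omega] at this
  linarith

lemma IsBackwardCoherent.antitone [IsProbabilityMeasure μ]
    (hf : MeasurePreserving f μ μ) {W : X → Set ℕ} (hW : IsBackwardCoherent f W) :
    Antitone fun n : ℕ => μ.real {x | n + 1 ∈ W x} := by
  intro N n hn
  obtain ⟨i, rfl⟩ := Nat.exists_eq_add_of_le hn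
  have := measureReal_mono (μ := μ) (hW.setOf_mem_subset N i)
  rwa [(hf.iterate i).measureReal_preimage (hW.measurableSet_mem _).nullMeasurableSet,
    show N + 1 + i = N + i + 1 by omega] at this

lemma exists_eventDensity_inter_shift_pos [IsProbabilityMeasure μ] (hf : Ergodic f μ)
    {W U : X → Set ℕ} (hW : IsBackwardCoherent f W) (hU : IsBackwardCoherent f U)
    (hWpos : 0 < eventDensity μ W) (hUpos : 0 < eventDensity μ U) :
    ∃ ℓ : ℕ, 0 < eventDensity μ fun x => {n | n ∈ W x ∧ n + ℓ ∈ U x} := by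
  set a := eventDensity μ W with ha
  set b := eventDensity μ U with hb
  have hab : 0 < a * b := mul_pos hWpos hUpos
  -- The overlap will exceed `3ab/4`; each family loses less than `ab/4`, which leaves `ab/4`
  -- uniformly in `i`.
  obtain ⟨N₁, hN₁⟩ := exists_lt_of_ciInf_lt (show eventDensity μ W < a + a * b / 4 by linarith)
  obtain ⟨N₂, hN₂⟩ := exists_lt_of_ciInf_lt (show eventDensity μ U < b + a * b / 4 by linarith)
  set N := max N₁ N₂
  have hNW := (hW.antitone hf.toMeasurePreserving (le_max_left N₁ N₂)).trans_lt hN₁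
  have hNU := (hU.antitone hf.toMeasurePreserving (le_max_right N₁ N₂)).trans_lt hN₂
  have hprod : 3 * (a * b) / 4 < μ.real {x | N + 1 ∈ W x} * μ.real {x | N + 1 ∈ U x} := by
    have := mul_le_mul (eventDensity_le (μ := μ) W N) (eventDensity_le (μ := μ) U N) hUpos.le
      measureReal_nonneg
    linarith
  obtain ⟨ℓ, hℓ⟩ := exists_measureReal_inter_preimage_gt hf
    (hU.measurableSet_mem (N + 1)) hprod
  refine ⟨ℓ, ?_⟩
  have hanti := (hW.inter_shift hU ℓ).antitone hf.toMeasurePreserving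
  have hmeas := (hW.inter_shift hU ℓ).measurableSet_mem
  suffices h : ∀ i : ℕ, a * b / 4 ≤ μ.real {x | N + 1 + i ∈ W x ∧ N + 1 + i + ℓ ∈ U x} by
    refine (show 0 < a * b / 4 by linarith).trans_le (le_ciInf fun n => ?_)
    have h1 := hanti (show n ≤ N + n by omega)
    have h2 := h n
    rw [show N + 1 + n = N + n + 1 by omega] at h2
    exact h2.trans h1
  intro i
  have hW' := hW.measureReal_diff_le hf.toMeasurePreserving N i
  have hU' := hU.measureReal_diff_le hf.toMeasurePreserving N (i + ℓ)
  have hpre := (hf.toMeasurePreserving.iterate i).measureReal_preimage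
    (((hW.measurableSet_mem (N + 1)).inter
      ((hf.measurable.iterate ℓ) (hU.measurableSet_mem (N + 1)))).nullMeasurableSet)
  -- A point of the pulled-back overlap fails to be synchronized only if one of the two events is
  -- lost.
  have hcover : f^[i] ⁻¹' ({x | N + 1 ∈ W x} ∩ f^[ℓ] ⁻¹' {x | N + 1 ∈ U x}) ⊆
      {x | N + 1 + i ∈ W x ∧ N + 1 + i + ℓ ∈ U x} ∪
        ((f^[i] ⁻¹' {x | N + 1 ∈ W x} \ {x | N + 1 + i ∈ W x}) ∪
        (f^[i + ℓ] ⁻¹' {x | N + 1 ∈ U x} \ {x | N + 1 + (i + ℓ) ∈ U x})) := by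
    rintro x ⟨h1, h2⟩
    have h3 : x ∈ f^[i + ℓ] ⁻¹' {x | N + 1 ∈ U x} := by
      rw [Set.mem_preimage, add_comm i ℓ, Function.iterate_add_apply]
      exact h2
    by_cases h4 : x ∈ {x | N + 1 + i ∈ W x}
    · by_cases h5 : x ∈ {x | N + 1 + (i + ℓ) ∈ U x}
      · exact Or.inl ⟨h4, by simpa only [add_assoc, Set.mem_ofPred_eq] using h5⟩
      · exact Or.inr (Or.inr ⟨h3, h5⟩)
    · exact Or.inr (Or.inl ⟨h1, h4⟩)
  have h6 := (measureReal_mono (μ := μ) hcover).trans ((measureReal_union_le _ _).trans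
    (add_le_add_right (measureReal_union_le _ _) _))
  rw [hpre] at h6
  linarith

lemma exists_shifts_eventDensity_pos [IsProbabilityMeasure μ] (hf : Ergodic f μ) {m : ℕ} :
    ∀ {W : X → Set ℕ} {U : Fin m → X → Set ℕ}, IsBackwardCoherent f W →
      (∀ k, IsBackwardCoherent f (U k)) → 0 < eventDensity μ W →
      (∀ k, 0 < eventDensity μ (U k)) →
      ∃ ℓ : Fin m → ℕ, IsBackwardCoherent f (fun x => {n | n ∈ W x ∧ ∀ k, n + ℓ k ∈ U k x}) ∧
        0 < eventDensity μ fun x => {n | n ∈ W x ∧ ∀ k, n + ℓ k ∈ U k x} := by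
  induction m with
  | zero =>
    intro W U hW _ hWpos _
    exact ⟨Fin.elim0, by simpa using hW, by simpa using hWpos⟩
  | succ m ih =>
    intro W U hW hU hWpos hUpos
    obtain ⟨p, hp⟩ := exists_eventDensity_inter_shift_pos hf hW (hU 0) hWpos (hUpos 0)
    obtain ⟨ℓ, h1, h2⟩ := ih (U := fun k => U k.succ) (hW.inter_shift (hU 0) p)
      (fun k => hU k.succ) hp (fun k => hUpos k.succ)
    refine ⟨Fin.cons p ℓ, ?_⟩
    simp only [Fin.forall_fin_succ, Fin.cons_zero, Fin.cons_succ, ← and_assoc]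
    exact ⟨h1, h2⟩

lemma IsCoherentSchedule.zero_notMem {U : X → Set ℕ} (hU : IsCoherentSchedule f U) (x : X) :
    0 ∉ U x := fun h => absurd (hU.pos x 0 h) (by omega)

/-- A single typical point suffices: there the upper density is the limit of the frequencies. -/
lemma IsCoherentSchedule.eventDensity_pos [IsProbabilityMeasure μ] (hf : Ergodic f μ)
    {U : X → Set ℕ} (hU : IsCoherentSchedule f U) (hpos : ∀ᵐ x ∂μ, 0 < upperDensity (U x)) :
    0 < eventDensity μ U := by
  obtain ⟨x, h1, h2⟩ := (hpos.and (hU.isBackwardCoherent.ae_tendsto hf)).exists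
  simp only [← frequency_eq U x (hU.zero_notMem x)] at h2
  rwa [upperDensity, h2.limsup_eq] at h1

end ScheduleSync

theorem theoremE {X : Type*} [MeasurableSpace X] (f : X → X)
    (hf : ScheduleSync.IsBimeasurable f)
    (μ : Measure X) [IsProbabilityMeasure μ] (hμ : Ergodic f μ)
    (m : ℕ) (𝒰 : Fin (m + 1) → X → Set ℕ)
    (h𝒰 : ∀ i : Fin (m + 1), ScheduleSync.IsCoherentSchedule f (𝒰 i))
    (hpos : ∀ i : Fin (m + 1), ∀ᵐ x ∂μ, 0 < ScheduleSync.upperDensity (𝒰 i x)) :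
    ∃ (ℓ : Fin m → ℕ) (θ : ℝ), 0 < θ ∧ ∀ᵐ x ∂μ,
      Tendsto
        (fun n : ℕ =>
          (Set.ncard {j : ℕ | j < n ∧ j ∈ 𝒰 0 x ∧ ∀ k : Fin m, j + ℓ k ∈ 𝒰 k.succ x} : ℝ) / (n : ℝ))
        atTop (𝓝 θ) := by
  have hdens := fun i => (h𝒰 i).eventDensity_pos hμ (hpos i)
  obtain ⟨ℓ, hcoh, hθ⟩ := ScheduleSync.exists_shifts_eventDensity_pos hμ
    (h𝒰 0).isBackwardCoherent (fun k : Fin m => (h𝒰 k.succ).isBackwardCoherent) (hdens 0)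
    (fun k => hdens k.succ)
  refine ⟨ℓ, _, hθ, ?_⟩
  filter_upwards [hcoh.ae_tendsto hμ] with x hx
  -- As `0` is never an event, the times `j < n + 1` count the events in `{1, …, n}`; the factor `n
  -- / (n + 1)` corrects the denominator.
  rw [← tendsto_add_atTop_iff_nat 1]
  have hlim := hx.mul (tendsto_natCast_div_add_atTop (1 : ℝ))
  rw [mul_one] at hlim
  refine hlim.congr' ?_
  filter_upwards [eventually_gt_atTop 0] with n hn
  have hn' : (n : ℝ) ≠ 0 := by exact_mod_cast hn.ne'
  rw [← ScheduleSync.ncard_lt_succ_and_mem _ x fun h => (h𝒰 0).zero_notMem x h.1]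
  simp only [Set.mem_ofPred_eq]
  push_cast
  field_simp
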